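/- Let $X$ be a topological space, let $\mathbf K$ be a (locally small) category with all small colimits, and let $\mathbf{Pro}(\mathbf K)$ be its pro-category, i.e. the opposite of the full subcategory of $\mathbf{Set}^{\mathbf K}$ of small filtered colimits of functors $\mathrm{Hom}_{\mathbf K}(Y,-)$. A precosheaf on $X$ with values in $\mathbf{Pro}(\mathbf K)$ is a functor $\mathcal A$ from the poset of open subsets of $X$ to $\mathbf{Pro}(\mathbf K)$; it is a cosheaf if for every open $U\subseteq X$ and every covering sieve $R$ on $U$ (a downward closed family of open subsets of $U$ with union $U$) the canonical morphism $\varinjlim_{V\in R}\mathcal A(V)\to\mathcal A(U)$ is an isomorphism. The costalk of $\mathcal A$ at $x\in X$ is $\mathcal A^x=\varprojlim_{U\ni x}\mathcal A(U)$, the limit being taken in $\mathbf{Pro}(\mathbf K)$ over the open neighbourhoods of $x$. A morphism $\mathcal A\to\mathcal B$ of precosheaves is a strong local isomorphism if $\mathcal A^x\to\mathcal B^x$ is an isomorphism in $\mathbf{Pro}(\mathbf K)$ for every $x\in X$. Put $\mathcal A_+(U)=\varprojlim_R\varinjlim_{V\in R}\mathcal A(V)$, where $R$ runs over the covering sieves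 on $U$ and limits and colimits are taken in $\mathbf{Pro}(\mathbf K)$, with its canonical morphism $\mathcal A_+\to\mathcal A$, and let $\mathcal A_\#=(\mathcal A_+)_+$, with the composite $\varepsilon_{\mathcal A}\colon\mathcal A_\#\to\mathcal A_+\to\mathcal A$. **Theorem 2.3.** For every precosheaf $\mathcal A$ on $X$ with values in $\mathbf{Pro}(\mathbf K)$, $\varepsilon_{\mathcal A}\colon\mathcal A_\#\to\mathcal A$ is the cosheafification of $\mathcal A$: $\mathcal A_\#$ is a cosheaf, and every morphism $\mathcal B\to\mathcal A$ from a cosheaf $\mathcal B$ factors uniquely through $\varepsilon_{\mathcal A}$. Moreover: 1. For every precosheaf $\mathcal A$ on $X$ with values in $\mathbf{Pro}(\mathbf K)$, $\varepsilon_{\mathcal A}\colon\mathcal A_\#\to\mathcal A$ is a strong local isomorphism. 2. Every strong local isomorphism $\mathcal A\to\mathcal B$ between cosheaves on $X$ with values in $\mathbf{Pro}(\mathbf K)$ is an isomorphism. 3. If $f\colon\mathcal B\to\mathcal A$ is a strong local isomorphism of precosheaves on $X$ with values in $\mathbf{Pro}(\mathbf K)$ and $\mathcal B$ is a cosheaf,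 then the natural morphism $\mathcal B\to\mathcal A_\#$ (the unique $g$ with $\varepsilon_{\mathcal A}\circ g=f$) is an isomorphism. -/

import Mathlib

open CategoryTheory CategoryTheory.Limits TopologicalSpace Opposite

universe v u

namespace ProCosheaf

/-- The pro-category of `K`: the opposite of the full subcategory of functors `K ⥤ Type v` that are
small filtered colimits of corepresentable functors, i.e. the opposite of the category of
ind-objects of `Kᵒᵖ`. -/
abbrev Pro (K : Type u) [Category.{v} K] : Type (max u (v + 1)) := (Ind Kᵒᵖ)ᵒᵖ

/-- Precosheaves on the topological space `X` with values in `L`: covariant functors on the poset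
of open subsets. -/
abbrev Precosheaf (X : TopCat.{v}) (L : Type u) [Category.{v} L] := Opens X ⥤ L

/-- A precosheaf is a cosheaf if for every open `U` and every covering sieve `R` on `U` the
canonical morphism `colim_{(V ⟶ U) ∈ R} A(V) ⟶ A(U)` is an isomorphism, i.e. the canonical
cocone is a colimit cocone. -/
def IsCosheaf {X : TopCat.{v}} {L : Type u} [Category.{v} L] (A : Precosheaf X L) : Prop :=
  ∀ (U : Opens X) (R : Sieve U), R ∈ Opens.grothendieckTopology X U →
    Nonempty (IsColimit (A.mapCocone R.arrows.cocone))

noncomputable section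

variable {K : Type u} [Category.{v} K] {X : TopCat.{v}}

/-- The costalk `A^x = lim_{U ∋ x} A(U)`, a limit in `Pro K` over the open neighbourhoods of
`x`. -/
def costalk (A : Precosheaf X (Pro K)) (x : X) : Pro K :=
  limit (OpenNhds.inclusion x ⋙ A)

/-- The morphism of costalks induced by a morphism of precosheaves. -/
def costalkMap {A B : Precosheaf X (Pro K)} (f : A ⟶ B) (x : X) : costalk A x ⟶ costalk B x :=
  limMap (Functor.whiskerLeft (OpenNhds.inclusion x) f)

/-- A morphism of `Pro K`-valued precosheaves is a strong local isomorphism if it induces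
isomorphisms in `Pro K` on all costalks. -/
def IsStrongLocalIso {A B : Precosheaf X (Pro K)} (f : A ⟶ B) : Prop :=
  ∀ x : X, IsIso (costalkMap f x)

variable [HasColimits K]

/-- The plus construction `A₊(U) = lim_R colim_{(V ⟶ U) ∈ R} A(V)` (computed in `Pro K`), with
`R` running over the covering sieves on `U`. It is the dual of Mathlib's plus construction
`P⁺(U) = colim_R lim_{(V ⟶ U) ∈ R} P(V)`, applied to `A` viewed as a presheaf with values in
`(Pro K)ᵒᵖ ≃ Ind Kᵒᵖ`. -/
def plus (A : Precosheaf X (Pro K)) : Precosheaf X (Pro K) :=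
  ((Opens.grothendieckTopology X).plusObj A.leftOp).rightOp

/-- The canonical morphism `A₊ ⟶ A`, whose component at `U` is
`lim_R colim_{(V ⟶ U) ∈ R} A(V) ⟶ A(U)`. -/
def plusCounit (A : Precosheaf X (Pro K)) : plus A ⟶ A :=
  NatTrans.rightOp ((Opens.grothendieckTopology X).toPlus A.leftOp)

/-- The cosheafification `A_# = A₊₊`. -/
def cosheafify (A : Precosheaf X (Pro K)) : Precosheaf X (Pro K) :=
  plus (plus A)

/-- The canonical morphism `A_# = (A₊)₊ ⟶ A₊ ⟶ A`. -/
def counit (A : Precosheaf X (Pro K)) : cosheafify A ⟶ A :=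
  plusCounit (plus A) ≫ plusCounit A

end

end ProCosheaf

open ProCosheaf

noncomputable section

namespace CategoryTheory.Ind

variable {C : Type u} [Category.{v} C]

/-! A cosheaf in `Pro K` is a sheaf in `Ind Kᵒᵖ`, and everything reduces to sheaves of sets through
the functors `sections Z`. These jointly detect isomorphisms and limits, preserve filtered colimits,
and preserve limits because `Kᵒᵖ` has them. So the sheaf condition can be tested on sections, while
the plus construction and the stalks commute with taking sections. The set-level inputs are: the
double plus construction gives a sheaf, `toPlus` is locally bijective and hence bijective on stalks,
and stalks detect isomorphisms of sheaves. -/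

/-- The functor of sections `F ↦ F(Z)` on ind-objects, regarded as presheaves on `C`. -/
def sections (Z : Cᵒᵖ) : Ind C ⥤ Type v :=
  Ind.inclusion C ⋙ (evaluation Cᵒᵖ (Type v)).obj Z

instance (Z : Cᵒᵖ) [HasLimits C] : PreservesLimits (sections Z) := by
  unfold sections; infer_instance

instance (Z : Cᵒᵖ) {J : Type v} [SmallCategory J] [IsFiltered J] :
    PreservesColimitsOfShape J (sections Z) := by
  unfold sections; infer_instance

theorem isIso_iff_sections {F G : Ind C} (f : F ⟶ G) :
    IsIso f ↔ ∀ Z, IsIso ((sections Z).map f) := by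
  refine ⟨fun _ _ ↦ inferInstance, fun h ↦ ?_⟩
  have : IsIso ((Ind.inclusion C).map f) := by
    rw [NatTrans.isIso_iff_isIso_app]
    exact h
  exact isIso_of_fully_faithful (Ind.inclusion C) f

/-- The inclusion into presheaves is fully faithful, so it reflects limits, and limits of presheaves
are pointwise. -/
theorem nonempty_isLimit_iff_sections [HasLimits C] {J : Type v} [SmallCategory J]
    {F : J ⥤ Ind C} (c : Cone F) :
    Nonempty (IsLimit c) ↔ ∀ Z, Nonempty (IsLimit ((sections Z).mapCone c)) := by
  refine ⟨fun ⟨h⟩ _ ↦ ⟨isLimitOfPreserves _ h⟩, fun h ↦ ⟨?_⟩⟩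
  exact isLimitOfReflects (Ind.inclusion C)
    (evaluationJointlyReflectsLimits _ fun Z ↦ (h Z).some)

theorem isSheaf_iff_sections [HasLimits C] {S : Type v} [SmallCategory S]
    (J : GrothendieckTopology S) (P : Sᵒᵖ ⥤ Ind C) :
    Presheaf.IsSheaf J P ↔ ∀ Z, Presheaf.IsSheaf J (P ⋙ sections Z) := by
  simp only [Presheaf.isSheaf_iff_isLimit]
  have key : ∀ ⦃U : S⦄ (R : Sieve U), Nonempty (IsLimit (P.mapCone R.arrows.cocone.op)) ↔
      ∀ Z, Nonempty (IsLimit ((P ⋙ sections Z).mapCone R.arrows.cocone.op)) :=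
    fun U R ↦ nonempty_isLimit_iff_sections _
  exact ⟨fun h Z U R hR ↦ (key R).1 (h R hR) Z, fun h U R hR ↦ (key R).2 fun Z ↦ h Z R hR⟩

theorem isSheaf_plusObj_plusObj [HasLimits C] {S : Type v} [SmallCategory S]
    (J : GrothendieckTopology S) (P : Sᵒᵖ ⥤ Ind C) :
    Presheaf.IsSheaf J (J.plusObj (J.plusObj P)) := by
  rw [isSheaf_iff_sections]
  intro Z
  -- `plusObj` is a filtered colimit, over covers, of limits; `sections Z` preserves both.
  let e : J.plusObj (J.plusObj P) ⋙ sections Z ≅ J.plusObj (J.plusObj (P ⋙ sections Z)) :=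
    J.plusCompIso (sections Z) (J.plusObj P) ≪≫
      (J.plusFunctor (Type v)).mapIso (J.plusCompIso (sections Z) P)
  exact Presheaf.isSheaf_of_iso_iff e |>.2 (GrothendieckTopology.Plus.isSheaf_plus_plus J _)

end CategoryTheory.Ind

namespace TopCat.Presheaf

variable {X : TopCat.{v}}

theorem isIso_stalkFunctor_map_of_locally_bijective {F G : X.Presheaf (Type v)} (f : F ⟶ G)
    [CategoryTheory.Presheaf.IsLocallyInjective (Opens.grothendieckTopology X) f]
    (hf : IsLocallySurjective f) (x : X) :
    IsIso ((stalkFunctor (Type v) x).map f) := by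
  rw [CategoryTheory.isIso_iff_bijective]
  refine ⟨fun s t h ↦ ?_, (locally_surjective_iff_surjective_on_stalks f).1 hf x⟩
  obtain ⟨U, hU, s, rfl⟩ := exists_germ_eq F s
  obtain ⟨V, hV, t, rfl⟩ := exists_germ_eq F t
  replace h : G.germ U x hU (f.app _ s) = G.germ V x hV (f.app _ t) := by
    rw [← stalkFunctor_map_germ_apply, ← stalkFunctor_map_germ_apply]
    exact h
  obtain ⟨W, hW, iU, iV, e⟩ := G.germ_eq x hU hV _ _ h
  have e' : f.app (op W) (F.map iU.op s) = f.app (op W) (F.map iV.op t) := by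
    rw [NatTrans.naturality_apply, NatTrans.naturality_apply]
    exact e
  -- The open sets on which the two restrictions agree cover `W`, so one of them contains `x`.
  obtain ⟨T, i, hT, hxT⟩ :=
    CategoryTheory.Presheaf.equalizerSieve_mem (Opens.grothendieckTopology X) f _ _ e' x hW
  rw [← F.germ_res_apply iU x hW s, ← F.germ_res_apply iV x hW t,
    ← F.germ_res_apply i x hxT, ← F.germ_res_apply i x hxT]
  exact congrArg _ hT

end TopCat.Presheaf

namespace ProCosheaf

variable {K : Type u} [Category.{v} K] {X : TopCat.{v}}

theorem isCosheaf_iff_isSheaf_leftOp {L : Type u} [Category.{v} L] (A : Precosheaf X Lᵒᵖ) :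
    IsCosheaf A ↔ Presheaf.IsSheaf (Opens.grothendieckTopology X) A.leftOp := by
  rw [Presheaf.isSheaf_iff_isLimit]
  refine forall₃_congr fun U R _ ↦ ⟨fun ⟨h⟩ ↦ ⟨?_⟩, fun ⟨h⟩ ↦ ⟨?_⟩⟩
  · exact isLimitConeLeftOpOfCocone _ h
  · exact isColimitOfConeLeftOpOfCocone _ h

/-- The presheaf of sets `U ↦ A(U)(Z)`, for `A(U)` regarded as an ind-object of `Kᵒᵖ`. -/
abbrev sectionsPresheaf (A : Precosheaf X (Pro K)) (Z : Kᵒᵖᵒᵖ) : X.Presheaf (Type v) :=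
  A.leftOp ⋙ Ind.sections Z

/-- The map induced by a morphism of precosheaves on the presheaves `U ↦ A(U)(Z)`. -/
abbrev sectionsMap {A B : Precosheaf X (Pro K)} (f : A ⟶ B) (Z : Kᵒᵖᵒᵖ) :
    sectionsPresheaf B Z ⟶ sectionsPresheaf A Z :=
  Functor.whiskerRight (NatTrans.leftOp f) (Ind.sections Z)

/-- The projection `A^x ⟶ A(U)` for an open neighbourhood `U` of `x`. -/
def costalkπ (A : Precosheaf X (Pro K)) (x : X) (U : Opens X) (hU : x ∈ U) :
    costalk A x ⟶ A.obj U :=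
  limit.π (OpenNhds.inclusion x ⋙ A) (⟨U, hU⟩ : OpenNhds x)

theorem costalkMap_π {A B : Precosheaf X (Pro K)} (f : A ⟶ B) (x : X) (U : Opens X)
    (hU : x ∈ U) : costalkMap f x ≫ costalkπ B x U hU = costalkπ A x U hU ≫ f.app U :=
  limMap_π _ _

theorem costalk_hom_ext {A : Precosheaf X (Pro K)} {x : X} {T : Pro K} {g h : T ⟶ costalk A x}
    (w : ∀ U hU, g ≫ costalkπ A x U hU = h ≫ costalkπ A x U hU) : g = h :=
  limit.hom_ext fun U ↦ w U.1 U.2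

/-- The sections over `Z` of the costalk of `A` form the stalk of `U ↦ A(U)(Z)`. -/
def sectionsCostalkIso (A : Precosheaf X (Pro K)) (x : X) (Z : Kᵒᵖᵒᵖ) :
    (TopCat.Presheaf.stalkFunctor (Type v) x).obj (sectionsPresheaf A Z) ≅
      (Ind.sections Z).obj (costalk A x).unop :=
  (colimit.isColimit _).coconePointUniqueUpToIso
    (isColimitOfPreserves (Ind.sections Z)
      (isColimitCoconeLeftOpOfCone _ (limit.isLimit (OpenNhds.inclusion x ⋙ A))))

theorem germ_sectionsCostalkIso_hom (A : Precosheaf X (Pro K)) (x : X) (Z : Kᵒᵖᵒᵖ)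
    (U : Opens X) (hU : x ∈ U) :
    (sectionsPresheaf A Z).germ U x hU ≫ (sectionsCostalkIso A x Z).hom =
      (Ind.sections Z).map (costalkπ A x U hU).unop :=
  IsColimit.comp_coconePointUniqueUpToIso_hom _ _ _

theorem stalkFunctor_map_sectionsCostalkIso_hom {A B : Precosheaf X (Pro K)} (f : A ⟶ B) (x : X)
    (Z : Kᵒᵖᵒᵖ) :
    (TopCat.Presheaf.stalkFunctor (Type v) x).map (sectionsMap f Z) ≫
        (sectionsCostalkIso A x Z).hom =
      (sectionsCostalkIso B x Z).hom ≫ (Ind.sections Z).map (costalkMap f x).unop := by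
  refine TopCat.Presheaf.stalk_hom_ext _ fun U hU ↦ ?_
  refine (TopCat.Presheaf.stalkFunctor_map_germ_assoc U x hU _ _).trans ?_
  refine Eq.trans ?_ ((reassoc_of% germ_sectionsCostalkIso_hom B x Z U hU)
    ((Ind.sections Z).map (costalkMap f x).unop)).symm
  refine (congrArg ((sectionsMap f Z).app (op U) ≫ ·)
    (germ_sectionsCostalkIso_hom A x Z U hU)).trans ?_
  have h := congrArg (fun g ↦ (Ind.sections Z).map g.unop) (costalkMap_π f x U hU)
  simp only [unop_comp, Functor.map_comp] at h
  exact h.symm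

/-- Neighbourhoods of a point are cofiltered, so in `Ind Kᵒᵖ` a costalk is a filtered colimit, which
sections preserve. -/
theorem isStrongLocalIso_iff {A B : Precosheaf X (Pro K)} (f : A ⟶ B) :
    IsStrongLocalIso f ↔
      ∀ x Z, IsIso ((TopCat.Presheaf.stalkFunctor (Type v) x).map (sectionsMap f Z)) := by
  refine forall_congr' fun x ↦ ?_
  rw [← isIso_unop_iff, Ind.isIso_iff_sections]
  refine forall_congr' fun Z ↦ ?_
  rw [← isIso_comp_left_iff (sectionsCostalkIso B x Z).hom,
    ← stalkFunctor_map_sectionsCostalkIso_hom, isIso_comp_right_iff]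

theorem costalkMap_comp {A B C : Precosheaf X (Pro K)} (f : A ⟶ B) (g : B ⟶ C) (x : X) :
    costalkMap (f ≫ g) x = costalkMap f x ≫ costalkMap g x := by
  refine costalk_hom_ext fun U hU ↦ ?_
  rw [costalkMap_π, Category.assoc, costalkMap_π, ← Category.assoc, costalkMap_π,
    Category.assoc, NatTrans.comp_app]

theorem IsStrongLocalIso.comp {A B C : Precosheaf X (Pro K)} {f : A ⟶ B} {g : B ⟶ C}
    (hf : IsStrongLocalIso f) (hg : IsStrongLocalIso g) : IsStrongLocalIso (f ≫ g) := fun x ↦ by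
  have := hf x
  have := hg x
  rw [costalkMap_comp]
  infer_instance

theorem IsStrongLocalIso.of_comp_right {A B C : Precosheaf X (Pro K)} {f : A ⟶ B} {g : B ⟶ C}
    (hg : IsStrongLocalIso g) (hfg : IsStrongLocalIso (f ≫ g)) : IsStrongLocalIso f := fun x ↦ by
  have := hg x
  have := hfg x
  rw [costalkMap_comp] at this
  exact IsIso.of_isIso_comp_right _ (costalkMap g x)

variable [HasColimits K]

theorem isIso_of_isStrongLocalIso {A B : Precosheaf X (Pro K)} (f : A ⟶ B) (hA : IsCosheaf A)
    (hB : IsCosheaf B) (hf : IsStrongLocalIso f) : IsIso f := by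
  rw [isCosheaf_iff_isSheaf_leftOp, Ind.isSheaf_iff_sections] at hA hB
  rw [isStrongLocalIso_iff] at hf
  have hf' (Z) : IsIso (sectionsMap f Z) := by
    let φ : (⟨_, hB Z⟩ : TopCat.Sheaf (Type v) X) ⟶ ⟨_, hA Z⟩ := ⟨sectionsMap f Z⟩
    have (x : X) : IsIso ((TopCat.Presheaf.stalkFunctor (Type v) x).map φ.1) := hf x Z
    have := TopCat.Presheaf.isIso_of_stalkFunctor_map_iso φ
    exact (TopCat.Sheaf.forget (Type v) X).map_isIso φ
  have happ (U : Opens X) : IsIso (f.app U) := by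
    rw [← isIso_unop_iff, Ind.isIso_iff_sections]
    intro Z
    exact (NatTrans.isIso_iff_isIso_app _).1 (hf' Z) (op U)
  exact NatIso.isIso_of_isIso_app f

theorem isStrongLocalIso_plusCounit (A : Precosheaf X (Pro K)) :
    IsStrongLocalIso (plusCounit A) := by
  rw [isStrongLocalIso_iff]
  intro x Z
  let J := Opens.grothendieckTopology X
  let P : X.Presheaf (Type v) := J.plusObj (sectionsPresheaf A Z)
  let t : sectionsPresheaf A Z ⟶ P := J.toPlus (sectionsPresheaf A Z)
  let e : sectionsPresheaf (plus A) Z ≅ P := J.plusCompIso (Ind.sections Z) A.leftOp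
  have h : sectionsMap (plusCounit A) Z = t ≫ e.inv :=
    (J.toPlus_comp_plusCompIso_inv _ _).symm
  have : Presheaf.IsLocallyInjective J t := Presheaf.isLocallyInjective_toPlus J _
  have := TopCat.Presheaf.isIso_stalkFunctor_map_of_locally_bijective t
    (Presheaf.isLocallySurjective_toPlus J _) x
  rw [h, Functor.map_comp]
  infer_instance

theorem isStrongLocalIso_counit (A : Precosheaf X (Pro K)) : IsStrongLocalIso (counit A) :=
  (isStrongLocalIso_plusCounit _).comp (isStrongLocalIso_plusCounit A)

theorem isCosheaf_cosheafify (A : Precosheaf X (Pro K)) : IsCosheaf (cosheafify A) :=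
  (isCosheaf_iff_isSheaf_leftOp _).2 (Ind.isSheaf_plusObj_plusObj _ A.leftOp)

theorem existsUnique_comp_plusCounit {A B : Precosheaf X (Pro K)} (f : B ⟶ A)
    (hB : IsCosheaf B) : ∃! g : B ⟶ plus A, g ≫ plusCounit A = f := by
  rw [isCosheaf_iff_isSheaf_leftOp] at hB
  let J := Opens.grothendieckTopology X
  -- Dually, a map into a sheaf extends uniquely along `toPlus`.
  refine ⟨NatTrans.rightOp (J.plusLift (NatTrans.leftOp f) hB), ?_, fun g hg ↦ ?_⟩
  · exact congrArg NatTrans.rightOp (J.toPlus_plusLift (NatTrans.leftOp f) hB)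
  · exact congrArg NatTrans.rightOp
      (J.plusLift_unique _ hB (NatTrans.leftOp g) (congrArg NatTrans.leftOp hg))

theorem existsUnique_comp_counit {A B : Precosheaf X (Pro K)} (f : B ⟶ A)
    (hB : IsCosheaf B) : ∃! g : B ⟶ cosheafify A, g ≫ counit A = f := by
  obtain ⟨g, rfl, hg⟩ := existsUnique_comp_plusCounit f hB
  obtain ⟨h, rfl, hh⟩ := existsUnique_comp_plusCounit g hB
  exact ⟨h, (Category.assoc _ _ _).symm,
    fun h' e ↦ hh h' (hg _ ((Category.assoc _ _ _).trans e))⟩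

end ProCosheaf

end

theorem theorem2p3 (K : Type u) [Category.{v} K] [HasColimits K] (X : TopCat.{v}) :
    -- `A_#`, with `A_# ⟶ A`, is the cosheafification (coreflection into cosheaves) of `A`
    (∀ A : Precosheaf X (Pro K),
      IsCosheaf (cosheafify A) ∧
      ∀ (B : Precosheaf X (Pro K)) (f : B ⟶ A), IsCosheaf B →
        ∃! g : B ⟶ cosheafify A, g ≫ counit A = f) ∧
    -- (1) `A_# ⟶ A` is a strong local isomorphism
    (∀ A : Precosheaf X (Pro K),
      IsStrongLocalIso (counit A)) ∧
    -- (2) a strong local isomorphism between cosheaves is an isomorphism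
    (∀ (A B : Precosheaf X (Pro K)) (f : A ⟶ B),
      IsCosheaf A → IsCosheaf B → IsStrongLocalIso f →
        IsIso f) ∧
    -- (3) for a strong local isomorphism `f : B ⟶ A` from a cosheaf, the natural morphism
    -- `B ⟶ A_#` (the unique one that lifts `f`) is an isomorphism
    (∀ (A B : Precosheaf X (Pro K)) (f : B ⟶ A),
      IsCosheaf B → IsStrongLocalIso f →
        ∃ g : B ⟶ cosheafify A, IsIso g ∧ g ≫ counit A = f ∧
          ∀ g' : B ⟶ cosheafify A, g' ≫ counit A = f → g' = g) := by
  refine ⟨fun A ↦ ⟨isCosheaf_cosheafify A, fun B f hB ↦ existsUnique_comp_counit f hB⟩,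
    isStrongLocalIso_counit, fun A B f ↦ isIso_of_isStrongLocalIso f, fun A B f hB hf ↦ ?_⟩
  obtain ⟨g, rfl, hg⟩ := existsUnique_comp_counit f hB
  -- By cancellation on costalks, `g` is a strong local isomorphism, here between cosheaves.
  exact ⟨g, isIso_of_isStrongLocalIso g hB (isCosheaf_cosheafify A)
    ((isStrongLocalIso_counit A).of_comp_right hf), rfl, hg⟩
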